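/- Let $k\ge 2$ be an integer not divisible by $4$, and let $H$ be a finite connected $k$-uniform hypergraph with vertex set $V$ and with at least one edge. (Here $H$ is $k$-uniform if every edge is a set of exactly $k$ distinct vertices, and connected if any two vertices are joined by a sequence of vertices in which consecutive ones lie in a common edge.) The adjacency tensor $\mathcal{A}_H=(a_{i_1\cdots i_k})$, indexed by $i_1,\dots,i_k\in V$, has $a_{i_1\cdots i_k}=\frac{1}{(k-1)!}$ if $\{i_1,\dots,i_k\}$ is an edge of $H$, and $a_{i_1\cdots i_k}=0$ otherwise. A number $\lambda\in\mathbb{C}$ is an eigenvalue of $H$ if there is a nonzero vector $x\in\mathbb{C}^V$ such that $$\sum_{i_2,\dots,i_k\in V}a_{ii_2\cdots i_k}x_{i_2}\cdots x_{i_k}=\lambda x_i^{k-1}\qquad\text{for all } i\in V,$$ and $\rho(\mathcal{A}_H)$ denotes the maximal modulus of the eigenvalues of $H$. The hypergraph $H$ is odd-bipartite if there is a proper subset $V_1$ of $V$ such that every edge of $H$ contains an odd number of vertices of $V_1$. Then the following are equivalent: (1) $k$ is even and $H$ is odd-bipartite; (2) $-\rho(\mathcal{A}_H)$ is an eigenvalue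 of $H$. -/

import Mathlib

/-- A complex tensor of order `k ≥ 2` with indices in `ι`. The entry `a_{i i₂ ⋯ i_k}` is `A i y`,
where `y = (i₂, …, i_k)`. -/
abbrev CubicalTensor (ι : Type*) (k : ℕ) : Type _ := ι → (Fin (k - 1) → ι) → ℂ

namespace CubicalTensor

variable {ι : Type*} [Fintype ι] {k : ℕ}

/-- The vector `A x`, `(A x)_i = ∑_{i₂, …, i_k} a_{i i₂ ⋯ i_k} x_{i₂} ⋯ x_{i_k}`. -/
def apply (A : CubicalTensor ι k) (x : ι → ℂ) (i : ι) : ℂ :=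
  ∑ y : Fin (k - 1) → ι, A i y * ∏ j, x (y j)

/-- `μ` is an eigenvalue of `A` if `A x = μ x^{[k-1]}` for some nonzero complex vector `x`. -/
def IsEigenvalue (A : CubicalTensor ι k) (μ : ℂ) : Prop :=
  ∃ x : ι → ℂ, x ≠ 0 ∧ ∀ i, A.apply x i = μ * x i ^ (k - 1)

/-- The spectral radius: the maximal modulus of the eigenvalues. -/
noncomputable def spectralRadius (A : CubicalTensor ι k) : ℝ :=
  sSup {r : ℝ | ∃ μ : ℂ, A.IsEigenvalue μ ∧ r = ‖μ‖}

end CubicalTensor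

namespace Hypergraph

variable {α : Type*}

/-- Each edge consists of exactly `k` vertices (used for `k ≥ 1`, so that edges are finite). -/
def IsUniform (H : Hypergraph α) (k : ℕ) : Prop :=
  ∀ e ∈ H.edgeSet, e.ncard = k

/-- There is a vertex, and any two vertices are joined by a finite sequence of vertices in which
consecutive ones lie in a common edge. -/
def IsConnected (H : Hypergraph α) : Prop :=
  H.vertexSet.Nonempty ∧
    ∀ u ∈ H.vertexSet, ∀ v ∈ H.vertexSet, Relation.ReflTransGen H.Adj u v

/-- Some proper subset `V₁` of the vertex set meets each edge in an odd number of vertices. -/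
def IsOddBipartite (H : Hypergraph α) : Prop :=
  ∃ V₁ : Set α, V₁ ⊂ H.vertexSet ∧ ∀ e ∈ H.edgeSet, Odd (e ∩ V₁).ncard

open Classical in
/-- The adjacency tensor of a `k`-uniform hypergraph: the entry at `(i₁, …, i_k)` is `1 / (k-1)!`
if `{i₁, …, i_k}` is an edge, and `0` otherwise. As an edge has `k` elements, the indices of a
nonzero entry are distinct. -/
noncomputable def adjacencyTensor (H : Hypergraph α) (k : ℕ) : CubicalTensor H.vertexSet k :=
  fun i y =>
    if insert (i : α) (Set.range fun j => (y j : α)) ∈ H.edgeSet then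
      1 / (Nat.factorial (k - 1) : ℂ)
    else 0

end Hypergraph

/-! On vectors indexed by the vertices, the adjacency tensor acts as the gradient of F(x) = ∑_e ∏_{j
∈ e} x_j. Let M be the maximum of F(x) / ∑ x_i ^ k over nonzero x ≥ 0. Connectedness makes every
maximizer positive (`maximizer_pos`), so the Lagrange condition (`edgeGrad_maximizer`) makes k M an
eigenvalue; the triangle inequality (`norm_eigenvalue_mul_le`) bounds all others by it, so ρ = k M.

If x is an eigenvector for -ρ, then |x| is a maximizer and the triangle inequality is an equality.
The phases u of x therefore satisfy ∏_{j ∈ e} u_j = -u_i ^ k for i ∈ e (`exists_phase`), and u_i ^ k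
is constant by connectedness. Dividing by one phase gives k-th roots of unity w with product -1 on
each edge. Taking k-th powers shows that k is even; when k = 2m with m odd, w_i ^ m = ±1 has product
-1 on each edge, so {w ^ m = -1} is an odd transversal. Conversely, flipping signs on an odd
transversal turns ρ into -ρ (`edgeGrad_sign_mul`). -/

section EdgeFamily

open Finset

variable {V R : Type*}

/-- The polynomial `∑_{e ∈ E} ∏_{j ∈ e} x_j` of a family `E` of finite sets. -/
def edgeForm [CommSemiring R] (E : Finset (Finset V)) (x : V → R) : R :=
  ∑ e ∈ E, ∏ j ∈ e, x j

/-- The partial derivative `∑_{i ∈ e ∈ E} ∏_{j ∈ e, j ≠ i} x_j` of `edgeForm E` at `x`. -/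
def edgeGrad [DecidableEq V] [CommSemiring R] (E : Finset (Finset V)) (x : V → R) (i : V) : R :=
  ∑ e ∈ E with i ∈ e, ∏ j ∈ e.erase i, x j

/-- Any two points are linked by a chain of members of `E`, stated as an induction principle. -/
def IsLinked (E : Finset (Finset V)) : Prop :=
  ∀ P : V → Prop, (∀ e ∈ E, ∀ i ∈ e, ∀ j ∈ e, P i → P j) → ∀ i j, P i → P j

theorem mul_edgeGrad [DecidableEq V] [CommSemiring R] (E : Finset (Finset V)) (x : V → R) (i : V) :
    x i * edgeGrad E x i = ∑ e ∈ E with i ∈ e, ∏ j ∈ e, x j := by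
  rw [edgeGrad, mul_sum]
  refine sum_congr rfl fun e he => ?_
  exact mul_prod_erase e x (mem_filter.1 he).2

theorem sum_mul_edgeGrad [DecidableEq V] [Fintype V] [CommSemiring R] {E : Finset (Finset V)} {k : ℕ}
    (hE : ∀ e ∈ E, #e = k) (x : V → R) :
    ∑ i, x i * edgeGrad E x i = k * edgeForm E x := by
  simp_rw [mul_edgeGrad, sum_filter]
  rw [sum_comm, edgeForm, mul_sum]
  refine sum_congr rfl fun e he => ?_
  rw [← sum_filter, filter_univ_mem, sum_const, hE e he, nsmul_eq_mul]

/-- A vertex occurs at most once in an edge, so the form is affine in each coordinate. -/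
theorem edgeForm_update [DecidableEq V] [CommRing R] (E : Finset (Finset V)) (x : V → R) (i : V) (t : R) :
    edgeForm E (Function.update x i t) = edgeForm E x + (t - x i) * edgeGrad E x i := by
  rw [sub_mul, mul_edgeGrad, edgeGrad, mul_sum, edgeForm, edgeForm, sum_filter, sum_filter,
    ← sum_sub_distrib, ← sum_add_distrib]
  refine sum_congr rfl fun e _ => ?_
  by_cases h : i ∈ e
  · simp only [h, if_true]
    rw [prod_update_of_mem h, sdiff_singleton_eq_erase]
    ring
  · simp only [h, if_false, sub_zero, add_zero]
    exact prod_update_of_notMem h _ _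

theorem edgeForm_mul [CommSemiring R] {E : Finset (Finset V)} {k : ℕ} (hE : ∀ e ∈ E, #e = k)
    (c : R) (x : V → R) : edgeForm E (fun i => c * x i) = c ^ k * edgeForm E x := by
  rw [edgeForm, edgeForm, mul_sum]
  refine sum_congr rfl fun e he => ?_
  rw [prod_mul_distrib, prod_const, hE e he]

theorem norm_edgeGrad_le [DecidableEq V] (E : Finset (Finset V)) (x : V → ℂ) (i : V) :
    ‖edgeGrad E x i‖ ≤ edgeGrad E (fun j => ‖x j‖) i := by
  refine (norm_sum_le _ _).trans_eq (sum_congr rfl fun e _ => ?_)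
  exact norm_prod _ _

theorem ofReal_edgeGrad [DecidableEq V] (E : Finset (Finset V)) (x : V → ℝ) (i : V) :
    ((edgeGrad E x i : ℝ) : ℂ) = edgeGrad E (fun j => (x j : ℂ)) i := by
  simp [edgeGrad]

/-! ### Perron–Frobenius theory by maximization. -/

/-- Compactness gives a maximum on the slice ∑ x_i ^ k = 1 of the nonnegative orthant; homogeneity
extends the bound. -/
theorem exists_edgeForm_maximizer [Fintype V] [Nonempty V] {E : Finset (Finset V)} {k : ℕ}
    (hk : k ≠ 0) (hE : ∀ e ∈ E, #e = k) :
    ∃ z : V → ℝ, (∀ i, 0 ≤ z i) ∧ ∑ i, z i ^ k = 1 ∧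
      ∀ x : V → ℝ, (∀ i, 0 ≤ x i) → edgeForm E x ≤ edgeForm E z * ∑ i, x i ^ k := by
  let K : Set (V → ℝ) := {x | (∀ i, 0 ≤ x i) ∧ ∑ i, x i ^ k = 1}
  have hKc : IsCompact K := by
    refine IsCompact.of_isClosed_subset (isCompact_Icc (a := (0 : V → ℝ)) (b := 1)) ?_ ?_
    · refine IsClosed.inter ?_ (isClosed_eq (by fun_prop) continuous_const)
      exact isClosed_Ici (a := (0 : V → ℝ))
    · rintro x ⟨h0, h1⟩
      refine ⟨h0, fun i => ?_⟩
      have : x i ^ k ≤ 1 := h1 ▸ single_le_sum (f := fun i => x i ^ k)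
        (fun j _ => pow_nonneg (h0 j) k) (mem_univ i)
      exact (pow_le_one_iff_of_nonneg (h0 i) hk).1 this
  have hKn : K.Nonempty := by
    classical
    obtain ⟨v⟩ := ‹Nonempty V›
    refine ⟨Pi.single v 1, fun i => ?_, ?_⟩
    · by_cases h : i = v
      · subst h; simp
      · simp [h]
    · rw [sum_eq_single v] <;> simp +contextual [hk]
  have hcont : Continuous (edgeForm E : (V → ℝ) → ℝ) := by unfold edgeForm; fun_prop
  obtain ⟨z, hz, hmax⟩ := hKc.exists_isMaxOn hKn hcont.continuousOn
  refine ⟨z, hz.1, hz.2, fun x hx => ?_⟩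
  set s := ∑ i, x i ^ k with hs
  have hs0 : 0 ≤ s := sum_nonneg fun i _ => pow_nonneg (hx i) k
  obtain ⟨c, hc0, hcs⟩ : ∃ c : ℝ, 0 ≤ c ∧ c ^ k = s :=
    ⟨s ^ (1 / k : ℝ), by positivity, by
      rw [one_div, Real.rpow_inv_natCast_pow hs0 hk]⟩
  rcases hc0.eq_or_lt with rfl | hc
  · rw [zero_pow hk] at hcs
    have hx0 : x = fun i => 0 * x i := by
      ext i
      have := (sum_eq_zero_iff_of_nonneg fun i _ => pow_nonneg (hx i) k).1 hcs.symm i (mem_univ i)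
      simp [pow_eq_zero_iff hk |>.1 this]
    rw [← hcs, hx0, edgeForm_mul hE, zero_pow hk]
    simp
  · have hmem : (fun i => c⁻¹ * x i) ∈ K := by
      refine ⟨fun i => mul_nonneg (inv_nonneg.2 hc.le) (hx i), ?_⟩
      simp_rw [mul_pow]
      rw [← mul_sum, ← hs, inv_pow, hcs, inv_mul_cancel₀]
      rw [← hcs]; positivity
    have h := hmax hmem
    simp only [Set.mem_ofPred_eq, edgeForm_mul hE] at h
    rw [inv_pow, hcs, inv_mul_le_iff₀ (by rw [← hcs]; positivity)] at h
    linarith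

/-- A nonnegative maximizer of `edgeForm E x / ∑ x_i ^ k` is positive. -/
theorem maximizer_pos [DecidableEq V] [Fintype V] {E : Finset (Finset V)} {k : ℕ} (hk : k ≠ 0)
    (hE : ∀ e ∈ E, #e = k) (hlink : IsLinked E) {M : ℝ}
    (hM : ∀ x : V → ℝ, (∀ i, 0 ≤ x i) → edgeForm E x ≤ M * ∑ i, x i ^ k)
    {z : V → ℝ} (hz : ∀ i, 0 ≤ z i) (hz0 : z ≠ 0) (hzM : M * ∑ i, z i ^ k ≤ edgeForm E z) (i : V) :
    0 < z i := by
  obtain ⟨v, hv⟩ := Function.ne_iff.1 hz0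
  refine hlink (fun i => 0 < z i) ?_ v i ((hz v).lt_of_ne' hv)
  intro e he a ha b hb hza
  by_contra hzb
  -- Raising the zeros of z in e to ε gains at least c ε ^ #Z in the form, with #Z ≤ k - 1 because z
  -- a > 0, but costs only M #Z ε ^ k on the other side. Small ε gives a contradiction.
  let Z := {l ∈ e | z l = 0}
  let c := ∏ l ∈ e with z l ≠ 0, z l
  have hc : 0 < c := prod_pos fun l hl => (hz l).lt_of_ne' (mem_filter.1 hl).2
  have hZk : #Z ≤ k - 1 := by
    have : #Z < #e := card_lt_card ⟨filter_subset _ _, fun h =>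
      hza.ne' (mem_filter.1 (h ha)).2⟩
    rw [hE e he] at this
    omega
  have hb0 : z b = 0 := le_antisymm (not_lt.1 hzb) (hz b)
  have key : ∀ ε : ℝ, 0 < ε → ε ≤ 1 → c ≤ M * #Z * ε := by
    intro ε hε hε1
    let x : V → ℝ := fun l => if l ∈ Z then ε else z l
    have hzx : ∀ l, z l ≤ x l := by
      intro l
      by_cases hl : l ∈ Z
      · simp only [x, hl, if_true, (mem_filter.1 hl).2, hε.le]
      · simp [x, hl]
    have hx : ∀ l, 0 ≤ x l := fun l => (hz l).trans (hzx l)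
    have hsum : ∑ l, x l ^ k = ∑ l, z l ^ k + #Z * ε ^ k := by
      have : ∀ l, x l ^ k = z l ^ k + if l ∈ Z then ε ^ k else 0 := by
        intro l
        by_cases hl : l ∈ Z
        · simp [x, hl, (mem_filter.1 hl).2, hk]
        · simp [x, hl]
      simp_rw [this, sum_add_distrib]
      simp
    have hprod : ∏ l ∈ e, x l = ε ^ #Z * c := by
      rw [← prod_filter_mul_prod_filter_not e (fun l => z l = 0)]
      congr 1
      · rw [prod_congr rfl (g := fun _ => ε), prod_const]
        intro l hl
        exact if_pos hl
      · refine prod_congr rfl fun l hl => if_neg fun h => ?_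
        exact (mem_filter.1 hl).2 (mem_filter.1 h).2
    have hform : edgeForm E z + ε ^ #Z * c ≤ edgeForm E x := by
      rw [edgeForm, edgeForm, ← add_sum_erase _ _ he, ← add_sum_erase _ _ he, hprod,
        prod_eq_zero hb hb0, zero_add, add_comm]
      gcongr
      · exact fun l _ => hz l
      · exact hzx _
    have h1 := hM x hx
    rw [hsum] at h1
    have h2 : ε ^ (k - 1) * c ≤ ε ^ #Z * c := by
      gcongr ?_ * c
      exact pow_le_pow_of_le_one hε.le hε1 hZk
    have h3 : ε ^ k = ε ^ (k - 1) * ε := (pow_sub_one_mul hk ε).symm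
    have h4 : ε ^ (k - 1) * c ≤ ε ^ (k - 1) * (M * #Z * ε) := by
      rw [h3] at h1
      linarith
    exact le_of_mul_le_mul_left h4 (by positivity)
  have hN : 0 < M * #Z := by
    have := key 1 one_pos le_rfl
    linarith
  -- This ε brings the bound in `key` down to at most c / 2.
  have h1 := key (min 1 (c / (2 * (M * #Z)))) (by positivity) (min_le_left _ _)
  have h2 : M * #Z * min 1 (c / (2 * (M * #Z))) ≤ M * #Z * (c / (2 * (M * #Z))) :=
    mul_le_mul_of_nonneg_left (min_le_right _ _) hN.le
  have h3 : M * #Z * (c / (2 * (M * #Z))) = c / 2 := by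
    rw [div_mul_eq_div_div, mul_div_cancel₀ _ hN.ne']
  linarith

/-- The Lagrange condition at a positive maximizer of `edgeForm E x / ∑ x_i ^ k`. -/
theorem edgeGrad_maximizer [DecidableEq V] [Fintype V] {E : Finset (Finset V)} {k : ℕ} {M : ℝ}
    (hM : ∀ x : V → ℝ, (∀ i, 0 ≤ x i) → edgeForm E x ≤ M * ∑ i, x i ^ k)
    {z : V → ℝ} (hz : ∀ i, 0 < z i) (hzM : M * ∑ i, z i ^ k ≤ edgeForm E z) (i : V) :
    edgeGrad E z i = k * M * z i ^ (k - 1) := by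
  -- The slack in `hM` as the i-th coordinate varies: nonnegative for t > 0 and zero at z i, hence
  -- critical there.
  let φ : ℝ → ℝ := fun t =>
    M * (∑ j ∈ univ.erase i, z j ^ k + t ^ k) - (edgeForm E z + (t - z i) * edgeGrad E z i)
  have hsum : ∀ t, ∑ j, Function.update z i t j ^ k = ∑ j ∈ univ.erase i, z j ^ k + t ^ k := by
    intro t
    rw [← add_sum_erase _ _ (mem_univ i), add_comm]
    congr 1
    · refine sum_congr rfl fun j hj => ?_
      rw [Function.update_of_ne (ne_of_mem_erase hj)]
    · simp
  have hφ : ∀ t, 0 < t → 0 ≤ φ t := by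
    intro t ht
    have := hM (Function.update z i t) fun j => by
      by_cases h : j = i
      · subst h; simp [ht.le]
      · simp [h, (hz j).le]
    rw [edgeForm_update, hsum] at this
    exact sub_nonneg.2 this
  have hφz : φ (z i) ≤ 0 := by
    have := hsum (z i)
    rw [Function.update_eq_self] at this
    simp only [φ, ← this]
    linarith
  have hmin : IsLocalMin φ (z i) := by
    filter_upwards [lt_mem_nhds (hz i)] with t ht
    exact hφz.trans (hφ t ht)
  have hd : HasDerivAt φ (M * (k * z i ^ (k - 1)) - edgeGrad E z i) (z i) := by
    refine ((hasDerivAt_pow k (z i)).const_add _ |>.const_mul M).sub ?_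
    simpa using (((hasDerivAt_id (z i)).sub_const (z i)).mul_const (edgeGrad E z i)).const_add
      (edgeForm E z)
  have := hmin.hasDerivAt_eq_zero hd
  linarith

end EdgeFamily

/-! ### Phases of eigenvectors and sign changes. -/

section EdgeFamily

open Finset

theorem sum_norm_pow_pos {V : Type*} [Fintype V] {k : ℕ} {x : V → ℂ} (hx : x ≠ 0) : 0 < ∑ i, ‖x i‖ ^ k := by
  obtain ⟨v, hv⟩ := Function.ne_iff.1 hx
  exact sum_pos' (fun i _ => by positivity) ⟨v, mem_univ v, pow_pos (norm_pos_iff.2 hv) k⟩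

variable {V : Type*} [DecidableEq V] {E : Finset (Finset V)} {k : ℕ}

/-- Equality case of the triangle inequality: after division by w, each real part is at most the
norm and the sums agree. -/
theorem eq_mul_norm_of_sum_eq {ι : Type*} {s : Finset ι} {f : ι → ℂ} {w : ℂ} (hw : ‖w‖ = 1)
    (h : ∑ i ∈ s, f i = w * ((∑ i ∈ s, ‖f i‖ : ℝ) : ℂ)) {i : ι} (hi : i ∈ s) :
    f i = w * ‖f i‖ := by
  have hw0 : w ≠ 0 := norm_ne_zero_iff.1 (by simp [hw])
  have hn : ∀ j, ‖w⁻¹ * f j‖ = ‖f j‖ := fun j => by simp [hw]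
  have hsum : ∑ j ∈ s, (w⁻¹ * f j).re = ∑ j ∈ s, ‖f j‖ := by
    rw [← Complex.re_sum, ← mul_sum, h, inv_mul_cancel_left₀ hw0, Complex.ofReal_re]
  have hre := (sum_eq_sum_iff_of_le fun j _ => (hn j) ▸ Complex.re_le_norm (w⁻¹ * f j)).1 hsum i hi
  rw [← hn i, Complex.re_eq_norm] at hre
  have h2 := Complex.eq_coe_norm_of_nonneg hre
  rw [hn, inv_mul_eq_iff_eq_mul₀ hw0] at h2
  exact h2

/-- Take norms in the i-th equation, multiply by ‖x i‖, sum, and apply Euler's identity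
`sum_mul_edgeGrad`. -/
theorem norm_eigenvalue_mul_le [Fintype V] (hk : k ≠ 0) (hE : ∀ e ∈ E, #e = k) {x : V → ℂ} {μ : ℂ}
    (hx : ∀ i, edgeGrad E x i = μ * x i ^ (k - 1)) :
    ‖μ‖ * ∑ i, ‖x i‖ ^ k ≤ k * edgeForm E fun i => ‖x i‖ := by
  rw [← sum_mul_edgeGrad hE, mul_sum]
  refine sum_le_sum fun i _ => ?_
  have h := norm_edgeGrad_le E x i
  rw [hx, norm_mul, norm_pow] at h
  calc ‖μ‖ * ‖x i‖ ^ k = ‖x i‖ * (‖μ‖ * ‖x i‖ ^ (k - 1)) := by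
        rw [← pow_sub_one_mul hk]; ring
    _ ≤ _ := by gcongr

/-- An eigenvector for `-k M`, with `M` the maximum of `edgeForm E x / ∑ x_i ^ k`, yields phases
`u` with `∏_{j ∈ e} u_j = - u_i ^ k` whenever `i ∈ e ∈ E`. -/
theorem exists_phase [Fintype V] (hk : k ≠ 0) (hE : ∀ e ∈ E, #e = k) (hlink : IsLinked E) {M : ℝ}
    (hM0 : 0 ≤ M) (hM : ∀ x : V → ℝ, (∀ i, 0 ≤ x i) → edgeForm E x ≤ M * ∑ i, x i ^ k)
    {x : V → ℂ} (hx0 : x ≠ 0)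
    (hx : ∀ i, edgeGrad E x i = -((k * M : ℝ) : ℂ) * x i ^ (k - 1)) :
    ∃ u : V → ℂ, (∀ i, u i ≠ 0) ∧ ∀ e ∈ E, ∀ i ∈ e, ∏ j ∈ e, u j = -u i ^ k := by
  let z : V → ℝ := fun i => ‖x i‖
  have hz : ∀ i, 0 ≤ z i := fun i => norm_nonneg _
  have hz0 : z ≠ 0 := fun h => hx0 (funext fun i => norm_eq_zero.1 (congrFun h i))
  have hzM : M * ∑ i, z i ^ k ≤ edgeForm E z := by
    have h := norm_eigenvalue_mul_le hk hE hx
    have hk' : (0 : ℝ) < k := by positivity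
    rw [norm_neg, Complex.norm_real, Real.norm_of_nonneg (by positivity), mul_assoc] at h
    exact le_of_mul_le_mul_left h hk'
  have hpos := maximizer_pos hk hE hlink hM hz hz0 hzM
  have hgrad := edgeGrad_maximizer hM hpos hzM
  have hzc : ∀ i, (z i : ℂ) ≠ 0 := fun i => Complex.ofReal_ne_zero.2 (hpos i).ne'
  have hxi : ∀ i, x i ≠ 0 := fun i => norm_pos_iff.1 (hpos i)
  refine ⟨fun i => x i / z i, fun i => div_ne_zero (hxi i) (hzc i), fun e he i hi => ?_⟩
  set u : V → ℂ := fun i => x i / z i with hu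
  have hun : ∀ j, ‖u j‖ = 1 := by
    intro j
    rw [hu, norm_div, Complex.norm_real, Real.norm_of_nonneg (hz j)]
    exact div_self (hpos j).ne'
  have hux : ∀ j, x j = u j * z j := fun j => (div_mul_cancel₀ _ (hzc j)).symm
  -- The Lagrange condition for z = |x| evaluates the sum of norms as k M z_i ^ (k - 1), which is
  -- the modulus of the sum itself.
  have hsum : edgeGrad E x i = -u i ^ (k - 1) *
      ((∑ e ∈ E with i ∈ e, ‖∏ j ∈ e.erase i, x j‖ : ℝ) : ℂ) := by
    simp_rw [norm_prod]
    change _ = _ * ((edgeGrad E z i : ℝ) : ℂ)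
    rw [hgrad, hx, hux]
    push_cast
    ring
  have hterm := eq_mul_norm_of_sum_eq (by simp [hun]) hsum (mem_filter.2 ⟨he, hi⟩)
  rw [norm_prod, prod_congr rfl fun j _ => hux j, prod_mul_distrib] at hterm
  push_cast at hterm
  have hne : ∏ j ∈ e.erase i, (z j : ℂ) ≠ 0 := prod_ne_zero_iff.2 fun j _ => hzc j
  have hfin := mul_right_cancel₀ hne hterm
  rw [← mul_prod_erase e u hi, hfin, ← pow_sub_one_mul hk]
  ring

theorem prod_ite_neg_one (e S : Finset V) :
    ∏ j ∈ e, (if j ∈ S then (-1 : ℂ) else 1) = (-1) ^ #(e ∩ S) := by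
  rw [prod_ite, prod_const, prod_const_one, mul_one, filter_mem_eq_inter]

/-- Phases as in `exists_phase` force `k` to be even and, if `4 ∤ k`, yield an odd transversal. -/
theorem even_and_exists_odd_of_phase (hk : k ≠ 0) (hk4 : ¬ 4 ∣ k) [Fintype V]
    (hE : ∀ e ∈ E, #e = k) (hlink : IsLinked E) (hne : E.Nonempty) {u : V → ℂ} (hu : ∀ i, u i ≠ 0)
    (h : ∀ e ∈ E, ∀ i ∈ e, ∏ j ∈ e, u j = -u i ^ k) :
    Even k ∧ ∃ S : Finset V, ∀ e ∈ E, Odd #(e ∩ S) := by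
  obtain ⟨e₀, he₀⟩ := hne
  obtain ⟨v, hv⟩ : e₀.Nonempty := card_pos.1 (by rw [hE _ he₀]; omega)
  have hconst : ∀ i, u i ^ k = u v ^ k := fun i => by
    refine hlink (fun i => u i ^ k = u v ^ k) ?_ v i rfl
    intro e he a ha b hb hab
    rw [← hab, ← neg_inj, ← h e he a ha, h e he b hb]
  let w : V → ℂ := fun i => u i / u v
  have hwk : ∀ i, w i ^ k = 1 := fun i => by
    rw [div_pow, hconst, div_self (pow_ne_zero _ (hu v))]
  have hwe : ∀ e ∈ E, ∏ j ∈ e, w j = -1 := by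
    intro e he
    obtain ⟨i, hi⟩ : e.Nonempty := card_pos.1 (by rw [hE _ he]; omega)
    rw [prod_div_distrib, prod_const, hE e he, h e he i hi, hconst, neg_div,
      div_self (pow_ne_zero _ (hu v))]
  have hkeven : Even k := by
    have h1 : (∏ j ∈ e₀, w j) ^ k = 1 := by
      rw [← prod_pow]
      exact prod_eq_one fun j _ => hwk j
    rw [hwe _ he₀] at h1
    by_contra hodd
    rw [(Nat.not_even_iff_odd.1 hodd).neg_one_pow] at h1
    norm_num at h1
  refine ⟨hkeven, ?_⟩
  obtain ⟨m, rfl⟩ := hkeven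
  -- Here 4 ∤ k enters; oddness of m keeps the edge products equal to -1 after taking m-th powers.
  have hm : Odd m := by
    rw [← Nat.not_even_iff_odd]
    rintro ⟨n, rfl⟩
    exact hk4 ⟨n, by ring⟩
  classical
  let S : Finset V := {i | w i ^ m = -1}
  have hS : ∀ i, w i ^ m = if i ∈ S then -1 else 1 := by
    intro i
    by_cases hi : w i ^ m = -1
    · simp [S, hi]
    · have := hwk i
      rw [pow_add, mul_self_eq_one_iff] at this
      simp [S, this.resolve_right hi]
  refine ⟨S, fun e he => ?_⟩
  have h1 : (∏ j ∈ e, w j) ^ m = -1 := by rw [hwe e he, hm.neg_one_pow]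
  rw [← prod_pow, prod_congr rfl fun j _ => hS j, prod_ite_neg_one] at h1
  by_contra hodd
  rw [(Nat.not_odd_iff_even.1 hodd).neg_one_pow] at h1
  norm_num at h1

/-- Changing signs on an odd transversal negates an eigenvalue if `k` is even. -/
theorem edgeGrad_sign_mul (hk : Even k) {S : Finset V} (hk0 : k ≠ 0)
    (hS : ∀ e ∈ E, Odd #(e ∩ S)) {x : V → ℂ} {μ : ℂ}
    (hx : ∀ i, edgeGrad E x i = μ * x i ^ (k - 1)) (i : V) :
    edgeGrad E (fun j => (if j ∈ S then -1 else 1) * x j) i =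
      -μ * ((if i ∈ S then -1 else 1) * x i) ^ (k - 1) := by
  set s : V → ℂ := fun j => if j ∈ S then -1 else 1 with hs
  have hss : ∀ j, s j * s j = 1 := fun j => by by_cases h : j ∈ S <;> simp [hs, h]
  have hsk : s i ^ (k - 1) = s i := by
    obtain ⟨m, rfl⟩ := hk
    rw [show m + m - 1 = 2 * (m - 1) + 1 by omega, pow_succ, pow_mul, pow_two, hss, one_pow,
      one_mul]
  have h1 : edgeGrad E (fun j => s j * x j) i = -s i * edgeGrad E x i := by
    rw [edgeGrad, edgeGrad, mul_sum]
    refine sum_congr rfl fun e he => ?_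
    obtain ⟨he, hi⟩ := mem_filter.1 he
    have h2 : s i * ∏ j ∈ e.erase i, s j = -1 := by
      rw [mul_prod_erase e s hi, hs, prod_ite_neg_one, (hS e he).neg_one_pow]
    have h3 : ∏ j ∈ e.erase i, s j = -s i := by
      rw [← one_mul (∏ j ∈ e.erase i, s j), ← hss i, mul_assoc, h2, mul_neg_one]
    rw [prod_mul_distrib, h3]
  change edgeGrad E (fun j => s j * x j) i = -μ * (s i * x i) ^ (k - 1)
  rw [h1, hx, mul_pow, hsk]
  ring

/-! ### From the tensor to the edge gradient. -/

/-- The tuples in the fiber are exactly the enumerations of e \ {i}; their number n! cancels the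
factor 1 / (k-1)! of the adjacency tensor. -/
theorem sum_fiber_insert_image {V R : Type*} [Fintype V] [DecidableEq V] [CommSemiring R] {n : ℕ}
    {e : Finset V} {i : V} (hi : i ∈ e) (he : #e = n + 1) (x : V → R) :
    ∑ y : Fin n → V with insert i (univ.image y) = e, ∏ j, x (y j) =
      n.factorial * ∏ j ∈ e.erase i, x j := by
  have hcard : #(e.erase i) = n := by rw [card_erase_of_mem hi, he]; rfl
  have hsum : ∑ y : Fin n → V with insert i (univ.image y) = e, ∏ j, x (y j) =
      ∑ σ : Fin n ≃ e.erase i, ∏ j, x (σ j) := by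
    symm
    refine sum_nbij (fun σ j => (σ j : V)) ?_ ?_ ?_ (fun _ _ => rfl)
    · intro σ _
      simp only [mem_filter, mem_univ, true_and]
      have : univ.image (fun j => (σ j : V)) = e.erase i := by
        ext v
        constructor
        · intro hv
          obtain ⟨j, _, rfl⟩ := mem_image.1 hv
          exact (σ j).2
        · intro hv
          exact mem_image.2 ⟨σ.symm ⟨v, hv⟩, mem_univ _, by simp⟩
      rw [this, insert_erase hi]
    · intro σ _ τ _ h
      exact Equiv.ext fun j => Subtype.ext (congrFun h j)
    · intro y hy
      have hy : insert i (univ.image y) = e := by simpa using hy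
      have hle : #(univ.image y) ≤ n := card_image_le.trans (by simp)
      -- Otherwise the image would be all of e, which has n + 1 elements.
      have hni : i ∉ univ.image y := by
        intro h
        rw [insert_eq_of_mem h] at hy
        rw [hy] at hle
        omega
      have himg : univ.image y = e.erase i := by rw [← hy, erase_insert hni]
      have hmem : ∀ j, y j ∈ e.erase i := fun j => himg ▸ mem_image_of_mem y (mem_univ j)
      have hsurj : Function.Surjective fun j => (⟨y j, hmem j⟩ : e.erase i) := by
        rintro ⟨v, hv⟩
        rw [← himg] at hv
        obtain ⟨j, _, rfl⟩ := mem_image.1 hv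
        exact ⟨j, rfl⟩
      have hbij := (Fintype.bijective_iff_surjective_and_card _).2 ⟨hsurj, by
        rw [Fintype.card_fin, Fintype.card_coe, hcard]⟩
      exact ⟨Equiv.ofBijective _ hbij, by simp, rfl⟩
  have hprod : ∀ σ : Fin n ≃ e.erase i, ∏ j, x (σ j) = ∏ j ∈ e.erase i, x j := by
    intro σ
    rw [Equiv.prod_comp σ fun l => x l, prod_coe_sort (e.erase i) x]
  rw [hsum, sum_congr rfl fun σ _ => hprod σ, sum_const, card_univ,
    Fintype.card_equiv ((equivFinOfCardEq hcard).symm), Fintype.card_fin, nsmul_eq_mul]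

end EdgeFamily

/-! ### Translation to hypergraphs and the spectral radius. -/

namespace Hypergraph

open Finset

variable {α : Type*} (H : Hypergraph α) [Fintype H.vertexSet] {k : ℕ}

open Classical in
/-- The edges, as finsets of vertices. -/
noncomputable def edgeFamily : Finset (Finset H.vertexSet) :=
  {e | Subtype.val '' (e : Set H.vertexSet) ∈ H.edgeSet}

variable {H}

theorem mem_edgeFamily {e : Finset H.vertexSet} :
    e ∈ H.edgeFamily ↔ Subtype.val '' (e : Set H.vertexSet) ∈ H.edgeSet := by
  simp [edgeFamily]

theorem exists_edgeFamily_image_eq {e : Set α} (he : e ∈ H.edgeSet) :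
    ∃ f ∈ H.edgeFamily, Subtype.val '' (f : Set H.vertexSet) = e := by
  classical
  have h : Subtype.val ''
      ((Subtype.val ⁻¹' e : Set H.vertexSet).toFinset : Set H.vertexSet) = e := by
    rw [Set.coe_toFinset, Subtype.image_preimage_coe]
    exact Set.inter_eq_right.2 (H.subset_vertexSet_of_mem_edgeSet he)
  exact ⟨_, mem_edgeFamily.2 (h.symm ▸ he), h⟩

theorem IsUniform.card_eq (hunif : H.IsUniform k) {e : Finset H.vertexSet}
    (he : e ∈ H.edgeFamily) : #e = k := by
  rw [← hunif _ (mem_edgeFamily.1 he), Set.ncard_image_of_injective _ Subtype.val_injective,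
    Set.ncard_coe_finset]

theorem IsConnected.isLinked (hconn : H.IsConnected) : IsLinked H.edgeFamily := by
  intro P hP i j hi
  -- `H.Adj` relates points of α, so membership in the vertex set is carried along the path.
  suffices ∀ v, Relation.ReflTransGen H.Adj i v → ∃ hv : v ∈ H.vertexSet, P ⟨v, hv⟩ from
    (this j (hconn.2 i i.2 j j.2)).2
  intro v hv
  induction hv with
  | refl => exact ⟨i.2, hi⟩
  | @tail a b _ hab ih =>
    obtain ⟨ha, hPa⟩ := ih
    obtain ⟨e, he, hae, hbe⟩ := hab
    have hb := H.mem_vertexSet_of_mem_edgeSet he hbe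
    obtain ⟨f, hf, rfl⟩ := exists_edgeFamily_image_eq he
    refine ⟨hb, hP f hf ⟨a, ha⟩ ?_ ⟨b, hb⟩ ?_ hPa⟩
    · simpa [ha] using hae
    · simpa [hb] using hbe

theorem insert_range_mem_edgeSet [DecidableEq H.vertexSet] {n : ℕ} (i : H.vertexSet)
    (y : Fin n → H.vertexSet) :
    insert (i : α) (Set.range fun j => (y j : α)) ∈ H.edgeSet ↔
      insert i (univ.image y) ∈ H.edgeFamily := by
  rw [mem_edgeFamily, coe_insert, coe_image, coe_univ, Set.image_univ, Set.image_insert_eq,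
    ← Set.range_comp]
  rfl

theorem adjacencyTensor_apply [DecidableEq H.vertexSet] (hk : k ≠ 0) (hunif : H.IsUniform k)
    (x : H.vertexSet → ℂ) (i : H.vertexSet) :
    (H.adjacencyTensor k).apply x i = edgeGrad H.edgeFamily x i := by
  have h1 : (H.adjacencyTensor k).apply x i =
      ∑ y : Fin (k - 1) → H.vertexSet with insert i (univ.image y) ∈ H.edgeFamily,
        1 / ((k - 1).factorial : ℂ) * ∏ j, x (y j) := by
    rw [CubicalTensor.apply, sum_filter]
    refine sum_congr rfl fun y _ => ?_
    simp only [adjacencyTensor, insert_range_mem_edgeSet]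
    split_ifs <;> simp
  rw [h1, edgeGrad, ← sum_fiberwise_of_maps_to (t := {e ∈ H.edgeFamily | i ∈ e})
    (g := fun y => insert i (univ.image y))
    (fun y hy => mem_filter.2 ⟨(mem_filter.1 hy).2, mem_insert_self _ _⟩)]
  refine sum_congr rfl fun e he => ?_
  obtain ⟨he, hi⟩ := mem_filter.1 he
  have h2 : ({y ∈ ({y | insert i (univ.image y) ∈ H.edgeFamily} :
      Finset (Fin (k - 1) → H.vertexSet)) | insert i (univ.image y) = e} : Finset _) =
      ({y | insert i (univ.image y) = e} : Finset (Fin (k - 1) → H.vertexSet)) := by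
    ext y
    simp only [mem_filter, mem_univ, true_and, and_iff_right_iff_imp]
    rintro rfl
    exact he
  rw [h2, ← mul_sum, sum_fiber_insert_image hi (by rw [hunif.card_eq he]; omega), ← mul_assoc,
    one_div, inv_mul_cancel₀ (Nat.cast_ne_zero.2 (Nat.factorial_ne_zero _)), one_mul]

theorem isEigenvalue_adjacencyTensor_iff [DecidableEq H.vertexSet] (hk : k ≠ 0)
    (hunif : H.IsUniform k) {μ : ℂ} :
    (H.adjacencyTensor k).IsEigenvalue μ ↔
      ∃ x : H.vertexSet → ℂ, x ≠ 0 ∧ ∀ i, edgeGrad H.edgeFamily x i = μ * x i ^ (k - 1) := by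
  simp only [CubicalTensor.IsEigenvalue, adjacencyTensor_apply hk hunif]

theorem isOddBipartite_iff [DecidableEq H.vertexSet] (hk : Even k) (hunif : H.IsUniform k)
    (hedge : H.edgeSet.Nonempty) :
    H.IsOddBipartite ↔ ∃ S : Finset H.vertexSet, ∀ e ∈ H.edgeFamily, Odd #(e ∩ S) := by
  have hcard : ∀ e S : Finset H.vertexSet,
      (Subtype.val '' (e : Set H.vertexSet) ∩ Subtype.val '' (S : Set H.vertexSet)).ncard =
        #(e ∩ S) := by
    intro e S
    rw [← Set.image_inter Subtype.val_injective,
      Set.ncard_image_of_injective _ Subtype.val_injective, ← coe_inter, Set.ncard_coe_finset]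
  constructor
  · classical
    rintro ⟨V₁, hV₁, hodd⟩
    refine ⟨(Subtype.val ⁻¹' V₁ : Set H.vertexSet).toFinset, fun e he => ?_⟩
    rw [← hcard, Set.coe_toFinset, Subtype.image_preimage_coe, Set.inter_eq_right.2 hV₁.subset]
    exact hodd _ (mem_edgeFamily.1 he)
  · rintro ⟨S, hS⟩
    have hodd : ∀ e ∈ H.edgeSet, Odd (e ∩ Subtype.val '' (S : Set H.vertexSet)).ncard := by
      intro e he
      obtain ⟨f, hf, rfl⟩ := exists_edgeFamily_image_eq he
      rw [hcard]
      exact hS f hf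
    -- Properness is automatic: the whole vertex set meets an edge in k vertices, an even number.
    refine ⟨_, (Subtype.coe_image_subset _ _).ssubset_of_ne fun h => ?_, hodd⟩
    obtain ⟨e, he⟩ := hedge
    have h1 := hodd e he
    rw [h, Set.inter_eq_left.2 (H.subset_vertexSet_of_mem_edgeSet he), hunif e he] at h1
    exact Nat.not_odd_iff_even.2 hk h1

/-- The spectral radius is an eigenvalue and equals `k` times the maximum of
`edgeForm x / ∑ x_i ^ k` over nonnegative `x`. -/
theorem exists_spectralRadius_eq (hk : k ≠ 0) (hunif : H.IsUniform k) (hconn : H.IsConnected) :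
    ∃ M : ℝ, 0 ≤ M ∧ (∀ x : H.vertexSet → ℝ, (∀ i, 0 ≤ x i) →
        edgeForm H.edgeFamily x ≤ M * ∑ i, x i ^ k) ∧
      (H.adjacencyTensor k).spectralRadius = k * M ∧
      (H.adjacencyTensor k).IsEigenvalue ((k * M : ℝ) : ℂ) := by
  classical
  have : Nonempty H.vertexSet := hconn.1.to_subtype
  have hE : ∀ e ∈ H.edgeFamily, #e = k := fun e he => hunif.card_eq he
  obtain ⟨z, hz, hz1, hM⟩ := exists_edgeForm_maximizer hk hE
  have hz0 : z ≠ 0 := by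
    rintro rfl
    simp [hk] at hz1
  have hM0 : 0 ≤ edgeForm H.edgeFamily z := sum_nonneg fun e _ => prod_nonneg fun j _ => hz j
  have hzM : edgeForm H.edgeFamily z * ∑ i, z i ^ k ≤ edgeForm H.edgeFamily z := by
    rw [hz1, mul_one]
  have hpos := maximizer_pos hk hE hconn.isLinked hM hz hz0 hzM
  have heig : (H.adjacencyTensor k).IsEigenvalue ((k * edgeForm H.edgeFamily z : ℝ) : ℂ) := by
    rw [isEigenvalue_adjacencyTensor_iff hk hunif]
    refine ⟨fun i => z i, fun h => hz0 (funext fun i => Complex.ofReal_eq_zero.1 (congrFun h i)),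
      fun i => ?_⟩
    rw [← ofReal_edgeGrad, edgeGrad_maximizer hM hpos hzM]
    push_cast
    ring
  refine ⟨_, hM0, hM, ?_, heig⟩
  -- The supremum is attained, so the real `sSup` is a true maximum and not a default value.
  refine IsGreatest.csSup_eq ⟨⟨_, heig, ?_⟩, ?_⟩
  · rw [Complex.norm_real, Real.norm_of_nonneg (by positivity)]
  · rintro _ ⟨μ, hμ, rfl⟩
    obtain ⟨x, hx0, hx⟩ := (isEigenvalue_adjacencyTensor_iff hk hunif).1 hμ
    refine le_of_mul_le_mul_right ?_ (sum_norm_pow_pos (k := k) hx0)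
    refine (norm_eigenvalue_mul_le hk hE hx).trans ?_
    rw [mul_assoc]
    gcongr
    exact hM _ fun i => norm_nonneg _

end Hypergraph

theorem theorem3p5 {α : Type*} (H : Hypergraph α) [Fintype H.vertexSet] (k : ℕ) (hk : 2 ≤ k)
    (hk4 : ¬ 4 ∣ k) (hunif : H.IsUniform k) (hconn : H.IsConnected)
    (hedge : H.edgeSet.Nonempty) :
    (Even k ∧ H.IsOddBipartite) ↔
      (H.adjacencyTensor k).IsEigenvalue (-((H.adjacencyTensor k).spectralRadius : ℂ)) := by
  classical
  have hk0 : k ≠ 0 := by omega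
  obtain ⟨M, hM0, hM, hρ, heig⟩ := Hypergraph.exists_spectralRadius_eq hk0 hunif hconn
  rw [hρ]
  constructor
  · rintro ⟨heven, hodd⟩
    obtain ⟨S, hS⟩ := (Hypergraph.isOddBipartite_iff heven hunif hedge).1 hodd
    rw [Hypergraph.isEigenvalue_adjacencyTensor_iff hk0 hunif] at heig ⊢
    obtain ⟨x, hx0, hx⟩ := heig
    refine ⟨fun j => (if j ∈ S then -1 else 1) * x j, fun h => hx0 (funext fun i => ?_),
      edgeGrad_sign_mul heven hk0 hS hx⟩
    refine (mul_eq_zero.1 (congrFun h i)).resolve_left ?_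
    split_ifs <;> simp
  · intro h
    obtain ⟨x, hx0, hx⟩ := (Hypergraph.isEigenvalue_adjacencyTensor_iff hk0 hunif).1 h
    obtain ⟨u, hu0, hu⟩ := exists_phase hk0 (fun e he => hunif.card_eq he) hconn.isLinked hM0 hM
      hx0 hx
    obtain ⟨e, he⟩ := hedge
    obtain ⟨f, hf, -⟩ := Hypergraph.exists_edgeFamily_image_eq he
    obtain ⟨heven, hS⟩ := even_and_exists_odd_of_phase hk0 hk4 (fun e he => hunif.card_eq he)
      hconn.isLinked ⟨f, hf⟩ hu0 hu
    exact ⟨heven, (Hypergraph.isOddBipartite_iff heven hunif ⟨e, he⟩).2 hS⟩
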